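/- Let $G$ be a connected weighted graph with finite or countable vertex set $V$ and weight $w:V\times V\to[0,\infty)$, where $w(u,v)=w(v,u)$, $w(v,v)=0$, $\sup_{v}\sum_{u}w(v,u)<\infty$, and $u,v$ are joined by an edge iff $w(u,v)\neq 0$. Let $L$ be its Laplacian, $(Lf)(v)=\sum_{u}(f(v)-f(u))\,w(v,u)$, a bounded positive semidefinite self-adjoint operator on the complex space $\ell^2(V)$. For $\omega>0$ the Paley--Wiener space $PW_\omega(L)$ is the image of the spectral projection $\mathbf 1_{[0,\omega]}(L)$. Let $\{S_j\}_{j\in J}$ be a cover of $V$ by pairwise disjoint finite sets, each with more than one vertex and such that the induced weighted subgraph on $S_j$ is connected. Let $\lambda_{1,j}$ be the first (smallest) nonzero eigenvalue of the Laplacian of the induced weighted subgraph on $S_j$. For each $j$ let $\psi_j\in\ell^2(V)$ be supported in $S_j$ with $\Psi_j(\chi_j)\neq0$, where $\Psi_j(f)=\langle f,\psi_j\rangle=\sum_{v}f(v)\overline{\psi_j(v)}$ and $\chi_j$ is the characteristic function of $S_j$. Put $$\theta_j=\frac{|S_j|\,\|\psi_j\|^2}{|\Psi_j(\chi_j)|^2},\qquad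 \Theta_\Xi=\sup_{j\in J}\theta_j,\qquad \Lambda_{\mathcal S}=\inf_{j\in J}\lambda_{1,j},$$ and assume $\Theta_\Xi<\infty$ and $$0<\omega<\frac{\Lambda_{\mathcal S}}{\Theta_\Xi}.$$ For $f\in\ell^2(V)$ and an integer $k\ge1$, the interpolating variational spline $s_k(f)$ is the minimizer of $\|L^{k/2}u\|$ among all $u\in\ell^2(V)$ with $\Psi_j(u)=\Psi_j(f)$ for every $j\in J$. Then $\gamma:=\frac{\Theta_\Xi}{\Lambda_{\mathcal S}}\,\omega<1$, and for every $f\in PW_\omega(L)$: for each $k=2^l$, $l=0,1,2,\dots$, the spline $s_k(f)$ exists and is unique; $f=\lim_{l\to\infty}s_{2^l}(f)$ in $\ell^2(V)$, so that $f$ is reconstructed from the values $\{\langle f,\psi_j\rangle\}_{j\in J}$; and $$\|f-s_k(f)\|\le 2\gamma^{k}\|f\|,\qquad k=2^l,\ l=0,1,2,\dots$$ -/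

import Mathlib

open Filter Topology
open scoped ComplexConjugate

noncomputable section

/-- The complex Hilbert space `ℓ²(V)`. -/
abbrev L2 (V : Type*) : Type _ := lp (fun _ : V => ℂ) 2

/-- An undirected weighted graph on the vertex set `V`: a symmetric nonnegative weight vanishing on
the diagonal, with finite and uniformly bounded vertex degrees (for finite `V` the last two
conditions hold automatically). Two vertices are joined by an edge iff their weight is nonzero. -/
structure WeightedGraph (V : Type*) where
  weight : V → V → ℝ
  weight_nonneg : ∀ u v, 0 ≤ weight u v
  weight_symm : ∀ u v, weight u v = weight v u
  weight_self : ∀ v, weight v v = 0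
  summable_weight : ∀ v, Summable (weight v)
  degree_bounded : ∃ C : ℝ, ∀ v, ∑' u, weight v u ≤ C

/-- The characteristic function `χ_s` of a finite set `s`, as an element of `ℓ²(V)`. -/
def charFun {V : Type*} (s : Finset V) : L2 V := by
  classical exact ∑ v ∈ s, lp.single 2 v (1 : ℂ)

namespace WeightedGraph

variable {V : Type*} (G : WeightedGraph V)

/-- The underlying simple graph: edges are the pairs of nonzero weight. -/
def toSimpleGraph : SimpleGraph V where
  Adj u v := G.weight u v ≠ 0
  symm := ⟨fun u v h => by rwa [G.weight_symm v u]⟩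
  loopless := ⟨fun v h => h (G.weight_self v)⟩

/-- The induced weighted subgraph on a set of vertices. -/
def induce (s : Set V) : WeightedGraph s where
  weight u v := G.weight u v
  weight_nonneg u v := G.weight_nonneg u v
  weight_symm u v := G.weight_symm u v
  weight_self v := G.weight_self v
  summable_weight v := (G.summable_weight v).subtype s
  degree_bounded := by
    obtain ⟨C, hC⟩ := G.degree_bounded
    exact ⟨C, fun v => ((G.summable_weight v).tsum_subtype_le _ s (G.weight_nonneg v)).trans (hC v)⟩

/-! ### The gradient as a bounded operator, used to see that the Laplacian is bounded and positive -/

lemma summable_sq (f : L2 V) : Summable fun v => ‖f v‖ ^ 2 := by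
  have := (lp.memℓp f).summable (by norm_num)
  simpa using this

lemma norm_sq_eq {W : Type*} (f : L2 W) : ‖f‖ ^ 2 = ∑' v, ‖f v‖ ^ 2 := by
  have := lp.norm_rpow_eq_tsum (p := 2) (by norm_num) f
  simpa using this

lemma exists_hasSum_left (f : L2 V) (C : ℝ) (hC : ∀ v, ∑' u, G.weight v u ≤ C) :
    ∃ a, a ≤ C * ‖f‖ ^ 2 ∧ HasSum (fun p : V × V => G.weight p.1 p.2 * ‖f p.1‖ ^ 2) a := by
  have hle : ∀ v, (∑' u, G.weight v u) * ‖f v‖ ^ 2 ≤ C * ‖f v‖ ^ 2 := fun v =>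
    mul_le_mul_of_nonneg_right (hC v) (sq_nonneg _)
  have hs : Summable fun v => (∑' u, G.weight v u) * ‖f v‖ ^ 2 :=
    Summable.of_nonneg_of_le
      (fun v => mul_nonneg (tsum_nonneg (G.weight_nonneg v)) (sq_nonneg _)) hle
      ((summable_sq f).mul_left C)
  have hsum : Summable (fun p : V × V => G.weight p.1 p.2 * ‖f p.1‖ ^ 2) := by
    refine (summable_prod_of_nonneg
      (fun p => mul_nonneg (G.weight_nonneg p.1 p.2) (sq_nonneg ‖f p.1‖))).mpr ⟨?_, ?_⟩
    · exact fun v => (G.summable_weight v).mul_right (‖f v‖ ^ 2)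
    · simpa only [tsum_mul_right] using hs
  refine ⟨_, ?_, hsum.hasSum⟩
  rw [hsum.tsum_prod' (fun v => (G.summable_weight v).mul_right (‖f v‖ ^ 2)), norm_sq_eq, ← tsum_mul_left]
  simp only [tsum_mul_right]
  exact hs.tsum_le_tsum hle ((summable_sq f).mul_left C)

lemma exists_hasSum_grad (f : L2 V) (C : ℝ) (hC : ∀ v, ∑' u, G.weight v u ≤ C) :
    ∃ a, a ≤ 2 * C * ‖f‖ ^ 2 ∧
      HasSum (fun p : V × V => G.weight p.1 p.2 / 2 * ‖f p.1 - f p.2‖ ^ 2) a := by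
  obtain ⟨a, ha, hs⟩ := G.exists_hasSum_left f C hC
  have hs' : HasSum (fun p : V × V => G.weight p.1 p.2 * ‖f p.2‖ ^ 2) a := by
    have := (Equiv.prodComm V V).hasSum_iff.mpr hs
    refine this.congr_fun ?_ |> fun h => h
    intro p
    simp [G.weight_symm p.1 p.2]
  have hle : ∀ p : V × V, G.weight p.1 p.2 / 2 * ‖f p.1 - f p.2‖ ^ 2 ≤
      G.weight p.1 p.2 * ‖f p.1‖ ^ 2 + G.weight p.1 p.2 * ‖f p.2‖ ^ 2 := by
    intro p
    have h1 : ‖f p.1 - f p.2‖ ^ 2 ≤ 2 * (‖f p.1‖ ^ 2 + ‖f p.2‖ ^ 2) := by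
      have := norm_sub_le (f p.1) (f p.2)
      nlinarith [norm_nonneg (f p.1 - f p.2), sq_nonneg (‖f p.1‖ - ‖f p.2‖)]
    nlinarith [G.weight_nonneg p.1 p.2]
  have hsum := Summable.of_nonneg_of_le
    (fun p : V × V => mul_nonneg (div_nonneg (G.weight_nonneg p.1 p.2) zero_le_two)
      (sq_nonneg ‖f p.1 - f p.2‖)) hle (hs.add hs').summable
  exact ⟨_, (hasSum_le hle hsum.hasSum (hs.add hs')).trans (by linarith), hsum.hasSum⟩

lemma norm_gradFun_sq (f : L2 V) (p : V × V) :
    ‖(Real.sqrt (G.weight p.1 p.2 / 2) : ℂ) * (f p.1 - f p.2)‖ ^ 2 =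
      G.weight p.1 p.2 / 2 * ‖f p.1 - f p.2‖ ^ 2 := by
  rw [norm_mul, mul_pow, Complex.norm_real, Real.norm_eq_abs, sq_abs,
    Real.sq_sqrt (div_nonneg (G.weight_nonneg _ _) zero_le_two)]

lemma memℓp_grad (f : L2 V) :
    Memℓp (fun p : V × V => (Real.sqrt (G.weight p.1 p.2 / 2) : ℂ) * (f p.1 - f p.2)) 2 := by
  obtain ⟨C, hC⟩ := G.degree_bounded
  obtain ⟨a, -, ha⟩ := G.exists_hasSum_grad f C hC
  refine memℓp_gen (ha.summable.congr fun p => ?_)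
  rw [← G.norm_gradFun_sq f p, ENNReal.toReal_ofNat, Real.rpow_ofNat]

/-- The weighted gradient `(u, v) ↦ √(w(u,v)/2) (f(u) - f(v))`. -/
def gradient : L2 V →L[ℂ] L2 (V × V) := by
  refine LinearMap.mkContinuousOfExistsBound
    { toFun := fun f => (⟨_, G.memℓp_grad f⟩ : L2 (V × V))
      map_add' := fun f g => by
        ext p
        simp only [lp.coeFn_add, Pi.add_apply]
        ring
      map_smul' := fun c f => by
        ext p
        simp only [lp.coeFn_smul, Pi.smul_apply, smul_eq_mul, RingHom.id_apply]
        ring } ?_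
  obtain ⟨C, hC⟩ := G.degree_bounded
  refine ⟨Real.sqrt (2 * C), fun f => ?_⟩
  obtain ⟨a, ha, hs⟩ := G.exists_hasSum_grad f C hC
  have h2 : ‖(⟨_, G.memℓp_grad f⟩ : L2 (V × V))‖ ^ 2 ≤ 2 * C * ‖f‖ ^ 2 := by
    rw [norm_sq_eq]
    refine le_trans (le_of_eq ?_) ha
    rw [← hs.tsum_eq]
    exact tsum_congr fun p => G.norm_gradFun_sq f p
  have h3 := Real.sqrt_le_sqrt h2
  rwa [Real.sqrt_sq (norm_nonneg _), Real.sqrt_mul' _ (sq_nonneg _),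
    Real.sqrt_sq (norm_nonneg _)] at h3

lemma gradient_apply (f : L2 V) (p : V × V) :
    G.gradient f p = (Real.sqrt (G.weight p.1 p.2 / 2) : ℂ) * (f p.1 - f p.2) := rfl

lemma summable_laplacian (f : L2 V) (v : V) :
    Summable fun u => (f v - f u) * (G.weight v u : ℂ) := by
  refine Summable.of_norm_bounded ((G.summable_weight v).mul_left (2 * ‖f‖)) fun u => ?_
  rw [norm_mul, Complex.norm_real, Real.norm_eq_abs, abs_of_nonneg (G.weight_nonneg _ _)]
  refine mul_le_mul_of_nonneg_right ?_ (G.weight_nonneg _ _)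
  refine (norm_sub_le _ _).trans ?_
  have h1 := lp.norm_apply_le_norm (p := 2) (by norm_num) f v
  have h2 := lp.norm_apply_le_norm (p := 2) (by norm_num) f u
  linarith

lemma adjoint_gradient_gradient_apply (f : L2 V) (v : V) :
    (ContinuousLinearMap.adjoint G.gradient (G.gradient f)) v =
      ∑' u, (f v - f u) * (G.weight v u : ℂ) := by
  classical
  set g : V × V → ℂ := fun p => (G.weight p.1 p.2 / 2 : ℂ) * (f p.1 - f p.2) with hg
  set S := ∑' u, (f v - f u) * (G.weight v u : ℂ) with hS
  have hSsum : HasSum (fun u => (f v - f u) * (G.weight v u : ℂ)) S :=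
    (G.summable_laplacian f v).hasSum
  have h1 : (ContinuousLinearMap.adjoint G.gradient (G.gradient f)) v =
      inner ℂ (lp.single 2 v (1 : ℂ) : L2 V)
        (ContinuousLinearMap.adjoint G.gradient (G.gradient f)) := by
    rw [lp.inner_single_left]
    simp
  rw [h1, ContinuousLinearMap.adjoint_inner_right, lp.inner_eq_tsum]
  have hterm : ∀ p : V × V, inner ℂ (G.gradient (lp.single 2 v (1 : ℂ)) p) (G.gradient f p) =
      (if p.1 = v then g p else 0) - (if p.2 = v then g p else 0) := by
    intro p
    have hsq : ((Real.sqrt (G.weight p.1 p.2 / 2) : ℂ)) * (Real.sqrt (G.weight p.1 p.2 / 2) : ℂ)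
        = (G.weight p.1 p.2 / 2 : ℂ) := by
      rw [← Complex.ofReal_mul,
        Real.mul_self_sqrt (div_nonneg (G.weight_nonneg _ _) zero_le_two)]
      simp
    rw [G.gradient_apply, G.gradient_apply]
    simp only [RCLike.inner_apply, map_mul, map_sub, Complex.conj_ofReal, lp.single_apply,
      Pi.single_apply, hg, ← hsq]
    split_ifs <;> simp <;> ring
  have hA : HasSum (fun p : V × V => if p.1 = v then g p else 0) (S / 2) := by
    have hinj : Function.Injective (fun u : V => (v, u)) := fun a b h => (Prod.mk.inj h).2
    rw [← hinj.hasSum_iff]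
    · refine (hSsum.div_const 2).congr_fun ?_
      intro u
      simp [hg]
      ring
    · rintro ⟨a, b⟩ h
      have : a ≠ v := fun hav => h ⟨b, by simp [hav]⟩
      simp [this]
  have hB : HasSum (fun p : V × V => if p.2 = v then g p else 0) (-(S / 2)) := by
    have hinj : Function.Injective (fun u : V => (u, v)) := fun a b h => (Prod.mk.inj h).1
    rw [← hinj.hasSum_iff]
    · refine (hSsum.div_const 2).neg.congr_fun ?_
      intro u
      simp [hg, G.weight_symm u v]
      ring
    · rintro ⟨a, b⟩ h
      have : b ≠ v := fun hav => h ⟨a, by simp [hav]⟩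
      simp [this]
  rw [tsum_congr hterm, (hA.sub hB).tsum_eq]
  ring

/-- The weighted graph Laplacian `(L f)(v) = ∑ᵤ (f(v) - f(u)) w(v,u)`, a bounded operator. -/
def laplacian : L2 V →L[ℂ] L2 V where
  toFun f := ⟨fun v => ∑' u, (f v - f u) * (G.weight v u : ℂ), by
    have h := lp.memℓp (ContinuousLinearMap.adjoint G.gradient (G.gradient f))
    rwa [funext fun v => G.adjoint_gradient_gradient_apply f v] at h⟩
  map_add' f g := by
    ext v
    change ∑' u, ((f + g) v - (f + g) u) * (G.weight v u : ℂ) = _ + _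
    rw [← adjoint_gradient_gradient_apply, map_add, map_add, lp.coeFn_add, Pi.add_apply,
      adjoint_gradient_gradient_apply, adjoint_gradient_gradient_apply]
  map_smul' c f := by
    ext v
    change ∑' u, ((c • f) v - (c • f) u) * (G.weight v u : ℂ) = c • _
    rw [← adjoint_gradient_gradient_apply, map_smul, map_smul, lp.coeFn_smul, Pi.smul_apply,
      adjoint_gradient_gradient_apply]
  cont := by
    convert (ContinuousLinearMap.adjoint G.gradient ∘L G.gradient).continuous using 2 with f
    ext v
    exact (G.adjoint_gradient_gradient_apply f v).symm

lemma laplacian_apply (f : L2 V) (v : V) :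
    G.laplacian f v = ∑' u, (f v - f u) * (G.weight v u : ℂ) := rfl

lemma laplacian_eq : G.laplacian = ContinuousLinearMap.adjoint G.gradient ∘L G.gradient := by
  ext f v
  exact (G.adjoint_gradient_gradient_apply f v).symm

/-- The Laplacian is positive semidefinite (and self-adjoint), so that the functional calculus
below applies to it. -/
lemma laplacian_nonneg : 0 ≤ G.laplacian := by
  rw [ContinuousLinearMap.nonneg_iff_isPositive, laplacian_eq]
  exact ContinuousLinearMap.isPositive_adjoint_comp_self _

/-- The first (smallest) nonzero eigenvalue `λ₁` of the Laplacian of a graph. -/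
def firstEigenvalue : ℝ :=
  sInf {μ : ℝ | μ ≠ 0 ∧ Module.End.HasEigenvalue (G.laplacian : L2 V →ₗ[ℂ] L2 V) (μ : ℂ)}

end WeightedGraph

/-! ### Spectral projections of a bounded self-adjoint operator -/

section Spectral

variable {H : Type*} [NormedAddCommGroup H] [InnerProductSpace ℂ H] [CompleteSpace H]

/-- Continuous functions decreasing pointwise, as `n → ∞`, to the indicator of `(-∞, ω]`. -/
def cutoff (ω : ℝ) (n : ℕ) (x : ℝ) : ℝ := max 0 (min 1 (1 - n * (x - ω)))

lemma continuous_cutoff (ω : ℝ) (n : ℕ) : Continuous (cutoff ω n) := by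
  unfold cutoff; fun_prop

lemma cutoff_nonneg (ω : ℝ) (n : ℕ) (x : ℝ) : 0 ≤ cutoff ω n x := le_max_left _ _

lemma cutoff_le_one (ω : ℝ) (n : ℕ) (x : ℝ) : cutoff ω n x ≤ 1 :=
  max_le zero_le_one (min_le_left _ _)

lemma cutoff_anti (ω : ℝ) {m n : ℕ} (h : m ≤ n) (x : ℝ) : cutoff ω n x ≤ cutoff ω m x := by
  unfold cutoff
  rcases le_or_gt x ω with hx | hx
  · have h1 : (0 : ℝ) ≤ (m : ℝ) * (ω - x) := mul_nonneg m.cast_nonneg (by linarith)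
    have h2 : min 1 (1 - (m : ℝ) * (x - ω)) = 1 := min_eq_left (by linarith)
    rw [h2]
    exact max_le_max le_rfl (min_le_left _ _)
  · have h1 : (m : ℝ) * (x - ω) ≤ n * (x - ω) :=
      mul_le_mul_of_nonneg_right (by exact_mod_cast h) (by linarith)
    exact max_le_max le_rfl (min_le_min le_rfl (by linarith))

lemma tendsto_cutoff (ω x : ℝ) :
    Tendsto (fun n => cutoff ω n x) atTop (𝓝 ((Set.Iic ω).indicator 1 x)) := by
  rcases le_or_gt x ω with hx | hx
  · rw [Set.indicator_of_mem (show x ∈ Set.Iic ω from hx)]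
    refine tendsto_const_nhds.congr fun n => ?_
    have h1 : (0 : ℝ) ≤ (n : ℝ) * (ω - x) := mul_nonneg n.cast_nonneg (by linarith)
    unfold cutoff
    rw [min_eq_left (by linarith), max_eq_right zero_le_one]
    rfl
  · rw [Set.indicator_of_notMem (show x ∉ Set.Iic ω from not_le.mpr hx)]
    obtain ⟨N, hN⟩ := exists_nat_ge (1 / (x - ω))
    refine tendsto_const_nhds.congr' ?_
    filter_upwards [eventually_ge_atTop N] with n hn
    have h0 : 0 < x - ω := by linarith
    have h1 : 1 ≤ (n : ℝ) * (x - ω) := by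
      rw [div_le_iff₀ h0] at hN
      exact hN.trans (mul_le_mul_of_nonneg_right (by exact_mod_cast hn) h0.le)
    unfold cutoff
    rw [max_eq_left]
    exact (min_le_right _ _).trans (by linarith)

lemma exists_tendsto_cutoff (T : H →L[ℂ] H) (ω : ℝ) (f : H) :
    ∃ g, Tendsto (fun n => cfc (cutoff ω n) T f) atTop (𝓝 g) := by
  by_cases hT : IsSelfAdjoint T
  swap
  · exact ⟨0, by simp [cfc_apply_of_not_predicate T hT]⟩
  set A : ℕ → H →L[ℂ] H := fun n => cfc (cutoff ω n) T with hA
  set a : ℕ → ℝ := fun n => RCLike.re (inner ℂ (A n f) f) with ha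
  have hc : ∀ n, ContinuousOn (cutoff ω n) (spectrum ℝ T) :=
    fun n => (continuous_cutoff ω n).continuousOn
  have key : ∀ m n, m ≤ n → ‖A m f - A n f‖ ^ 2 ≤ a m - a n := by
    intro m n hmn
    set D : H →L[ℂ] H := cfc (fun x => cutoff ω m x - cutoff ω n x) T with hD
    have hd : ContinuousOn (fun x => cutoff ω m x - cutoff ω n x) (spectrum ℝ T) :=
      (hc m).sub (hc n)
    have hDA : D = A m - A n := cfc_sub _ _ T (hc m) (hc n)
    have hDsa : IsSelfAdjoint D := cfc_predicate _ T
    have hDD : D * D ≤ D := by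
      rw [hD, ← cfc_mul _ _ T hd hd]
      refine cfc_mono (fun x _ => ?_) (hd.mul hd) hd
      have h1 := cutoff_anti ω hmn x
      have h2 := cutoff_nonneg ω n x
      have h3 := cutoff_le_one ω m x
      nlinarith
    have hpos := (ContinuousLinearMap.le_def _ _).mp hDD
    have h1 := hpos.re_inner_nonneg_left f
    have h2 : inner ℂ ((D * D) f) f = inner ℂ (D f) (D f) := by
      rw [mul_apply_eq_comp, ← ContinuousLinearMap.adjoint_inner_right,
        hDsa.adjoint_eq]
    rw [sub_apply, inner_sub_left, h2, map_sub,
      inner_self_eq_norm_sq] at h1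
    have h3 : RCLike.re (inner ℂ (D f) f) = a m - a n := by
      rw [hDA, sub_apply, inner_sub_left, map_sub]
    have h4 : D f = A m f - A n f := by rw [hDA, sub_apply]
    rw [← h4]
    linarith
  have hanti : Antitone a := fun m n hmn => by
    have := key m n hmn
    nlinarith [sq_nonneg ‖A m f - A n f‖]
  have hbdd : BddBelow (Set.range a) := by
    refine ⟨0, ?_⟩
    rintro _ ⟨n, rfl⟩
    have h0 : 0 ≤ A n := cfc_nonneg fun x _ => cutoff_nonneg ω n x
    exact ((ContinuousLinearMap.nonneg_iff_isPositive _).mp h0).re_inner_nonneg_left f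
  have hcau : CauchySeq a := (tendsto_atTop_ciInf hanti hbdd).cauchySeq
  refine cauchySeq_tendsto_of_complete ?_
  rw [Metric.cauchySeq_iff'] at hcau ⊢
  intro ε hε
  obtain ⟨N, hN⟩ := hcau (ε ^ 2) (by positivity)
  refine ⟨N, fun n hn => ?_⟩
  have h1 := key N n hn
  have h2 := hN n hn
  rw [dist_comm, Real.dist_eq] at h2
  have h3 : ‖A N f - A n f‖ ^ 2 < ε ^ 2 := h1.trans_lt ((le_abs_self _).trans_lt h2)
  rw [dist_comm, dist_eq_norm]
  exact lt_of_pow_lt_pow_left₀ 2 hε.le h3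

/-- The spectral projection `𝟏_{(-∞, ω]}(T)` of a bounded self-adjoint operator `T`, as the strong
limit of `φₙ(T)`, where the continuous functions `φₙ` decrease to the indicator of `(-∞, ω]`.
For `T ≥ 0` this is `𝟏_{[0, ω]}(T)`. -/
def spectralProjection (T : H →L[ℂ] H) (ω : ℝ) : H →L[ℂ] H :=
  continuousLinearMapOfTendsto (fun n => cfc (cutoff ω n) T)
    (f := fun f => (exists_tendsto_cutoff T ω f).choose)
    (tendsto_pi_nhds.mpr fun f => (exists_tendsto_cutoff T ω f).choose_spec)

lemma tendsto_spectralProjection (T : H →L[ℂ] H) (ω : ℝ) (f : H) :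
    Tendsto (fun n => cfc (cutoff ω n) T f) atTop (𝓝 (spectralProjection T ω f)) :=
  (exists_tendsto_cutoff T ω f).choose_spec

/-- The power `T ^ s` of a positive operator `T`, given by the functional calculus. -/
def operatorPow (T : H →L[ℂ] H) (s : ℝ) : H →L[ℂ] H := T ^ s

end Spectral

namespace WeightedGraph

variable {V : Type*} (G : WeightedGraph V)

/-- The Paley-Wiener space `PW_ω(L)`: the image of the spectral projection `𝟏_{[0, ω]}(L)`. -/
def paleyWiener (ω : ℝ) : Submodule ℂ (L2 V) :=
  LinearMap.range (spectralProjection G.laplacian ω : L2 V →ₗ[ℂ] L2 V)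

/-- `u` minimizes `‖L^{k/2} u‖` among all `u ∈ ℓ²(V)` with `⟨u, ψ j⟩ = a j` for all `j`.
(Mathlib's inner product is conjugate-linear in its first argument.) -/
def IsVariationalSpline {J : Type*} (ψ : J → L2 V) (k : ℕ) (a : J → ℂ) (u : L2 V) : Prop :=
  (∀ j, inner ℂ (ψ j) u = a j) ∧
    ∀ v : L2 V, (∀ j, inner ℂ (ψ j) v = a j) →
      ‖(operatorPow G.laplacian ((k : ℝ) / 2)) u‖ ≤ ‖(operatorPow G.laplacian ((k : ℝ) / 2)) v‖

/-- `Λ_S = inf_j λ_{1,j}`, with `λ_{1,j}` the first nonzero eigenvalue of the induced graph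
`S j`. -/
def coverLambda {J : Type*} (S : J → Finset V) : ℝ :=
  ⨅ j, (G.induce (S j : Set V)).firstEigenvalue

end WeightedGraph

/-- `θ = |S| ‖ψ‖² / |⟨χ_S, ψ⟩|²`. -/
def theta {V : Type*} (S : Finset V) (ψ : L2 V) : ℝ :=
  (S.card : ℝ) * ‖ψ‖ ^ 2 / ‖inner ℂ ψ (charFun S)‖ ^ 2

/-- `Θ_Ξ = sup_j θ_j`. -/
def coverTheta {V J : Type*} (S : J → Finset V) (ψ : J → L2 V) : ℝ :=
  ⨆ j, theta (S j) (ψ j)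

end

/-! Everything rests on a Poincaré inequality: with `a` = Θ/Λ, a function `h` annihilated by every
Ψ_j satisfies ‖h‖² ≤ a⟨Lh, h⟩. On one block, split `h` into a constant and a part `g` of mean zero.
The spectral gap bounds `g` by the block energy (`firstEigenvalue_mul_norm_sq_le`), and Ψ_j(h) = 0
lets `g` control the constant part at the cost of the factor θ_j (`norm_sq_add_smul_le`). Disjoint
blocks have disjoint edge sets, so the block energies sum to at most ⟨Lh, h⟩
(`norm_sq_le_of_forall_block`). Cauchy–Schwarz then doubles the exponent repeatedly, ‖h‖² ≤ a^k⟨L^k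
h, h⟩ for k = 2^l (`norm_sq_le_pow_mul_inner`), which is why k is a power of two.

Consequently L^{k/2} is bounded below on the common kernel M of the Ψ_j, and Hilbert space
projection gives a unique minimizer s on f + M, with L^{k/2}s orthogonal to L^{k/2}M. As f - s lies
in M, ‖f - s‖² ≤ a^k⟨L^k(f - s), f - s⟩ = a^k⟨L^k f, f - s⟩. Bernstein's inequality ‖L^k f‖ ≤ ω^k‖f‖
turns this into ‖f - s‖ ≤ (aω)^k‖f‖, and aω < 1 gives convergence. -/

noncomputable section

/-! ### Interpolation in Hilbert space -/

section Hilbert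

variable {H : Type*} [NormedAddCommGroup H] [InnerProductSpace ℂ H]

/-- Bessel's inequality for two orthogonal vectors, without normalization. -/
lemma bessel_two {χ g : H} (ψ : H) (h : inner ℂ χ g = 0) :
    ‖inner ℂ ψ χ‖ ^ 2 * ‖g‖ ^ 2 + ‖inner ℂ ψ g‖ ^ 2 * ‖χ‖ ^ 2 ≤ ‖ψ‖ ^ 2 * ‖χ‖ ^ 2 * ‖g‖ ^ 2 := by
  have h' : inner ℂ g χ = 0 := inner_eq_zero_symm.mp h
  set N := ‖inner ℂ ψ χ‖ ^ 2 * ‖g‖ ^ 2 + ‖inner ℂ ψ g‖ ^ 2 * ‖χ‖ ^ 2 with hN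
  -- This is ‖χ‖²‖g‖² times the projection of `ψ` onto the span of `χ` and `g`; clearing
  -- denominators allows either vector to be zero. Cauchy–Schwarz for ⟨ψ, z⟩ = N gives the claim
  -- after cancelling one factor `N`.
  set z : H := (conj (inner ℂ ψ χ) * (‖g‖ ^ 2 : ℝ) : ℂ) • χ
    + (conj (inner ℂ ψ g) * (‖χ‖ ^ 2 : ℝ) : ℂ) • g with hz
  have h1 : inner ℂ ψ z = (N : ℂ) := by
    rw [hz, inner_add_right, inner_smul_right, inner_smul_right, hN]
    push_cast
    rw [← Complex.conj_mul', ← Complex.conj_mul' (inner ℂ ψ g)]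
    ring
  have h2 : ‖z‖ ^ 2 = N * (‖χ‖ ^ 2 * ‖g‖ ^ 2) := by
    have := norm_add_sq_eq_norm_sq_add_norm_sq_of_inner_eq_zero
      ((conj (inner ℂ ψ χ) * (‖g‖ ^ 2 : ℝ) : ℂ) • χ) ((conj (inner ℂ ψ g) * (‖χ‖ ^ 2 : ℝ) : ℂ) • g)
      (by rw [inner_smul_left, inner_smul_right, h]; simp)
    rw [hz, pow_two, this, norm_smul, norm_smul, norm_mul, norm_mul, RCLike.norm_conj,
      RCLike.norm_conj, Complex.norm_real, Complex.norm_real, Real.norm_of_nonneg (sq_nonneg _),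
      Real.norm_of_nonneg (sq_nonneg _), hN]
    ring
  have hN0 : 0 ≤ N := by positivity
  have h3 : N ^ 2 ≤ ‖ψ‖ ^ 2 * (N * (‖χ‖ ^ 2 * ‖g‖ ^ 2)) := by
    have := norm_inner_le_norm (𝕜 := ℂ) ψ z
    rw [h1, Complex.norm_real, Real.norm_of_nonneg hN0] at this
    rw [← h2, ← mul_pow]
    exact pow_le_pow_left₀ hN0 this 2
  rcases hN0.eq_or_lt with h0 | h0
  · rw [← h0]; positivity
  · refine le_of_mul_le_mul_left ?_ h0
    linarith

/-- A vector orthogonal to `ψ` is controlled by its component orthogonal to `χ`. -/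
lemma norm_sq_add_smul_le {χ g : H} (ψ : H) (h : inner ℂ χ g = 0) {c : ℂ}
    (hx : inner ℂ ψ (g + c • χ) = 0) :
    ‖inner ℂ ψ χ‖ ^ 2 * ‖g + c • χ‖ ^ 2 ≤ ‖ψ‖ ^ 2 * ‖χ‖ ^ 2 * ‖g‖ ^ 2 := by
  refine le_trans (le_of_eq ?_) (bessel_two ψ h)
  rw [inner_add_right, inner_smul_right] at hx
  -- Since ⟨ψ, g⟩ = -c⟨ψ, χ⟩, the left side of Bessel becomes |⟨ψ, χ⟩|²(‖g‖² + |c|²‖χ‖²), and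
  -- Pythagoras finishes.
  have h1 : ‖inner ℂ ψ g‖ = ‖c‖ * ‖inner ℂ ψ χ‖ := by
    rw [eq_neg_of_add_eq_zero_left hx, norm_neg, norm_mul]
  have h2 := norm_add_sq_eq_norm_sq_add_norm_sq_of_inner_eq_zero g (c • χ)
      (by rw [inner_smul_right, inner_eq_zero_symm.mp h, mul_zero])
  rw [pow_two ‖g + c • χ‖, h2, h1, norm_smul]
  ring

/-- A minimizer of `‖B u‖` over a coset of `M` is characterized by orthogonality. -/
lemma inner_eq_zero_of_forall_norm_le {H' : Type*} [NormedAddCommGroup H'] [InnerProductSpace ℂ H']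
    (B : H →L[ℂ] H') (M : Submodule ℂ H) {u : H}
    (hu : ∀ h ∈ M, ‖B u‖ ≤ ‖B (u + h)‖) : ∀ h ∈ M, inner ℂ (B u) (B h) = 0 := by
  set K : Submodule ℂ H' := M.map (B : H →ₗ[ℂ] H') with hK
  -- Minimality says that 0 is the best approximation to `B u` from the image of `M`.
  have key : ‖B u - 0‖ = ⨅ w : K, ‖B u - w‖ := by
    refine le_antisymm (le_ciInf ?_) ?_
    · rintro ⟨_, h, hh, rfl⟩
      have := hu (-h) (M.neg_mem hh)
      simpa [sub_eq_add_neg] using this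
    · exact ciInf_le_of_le ⟨0, by rintro _ ⟨w, rfl⟩; positivity⟩ (0 : K) le_rfl
  have h0 := (K.norm_eq_iInf_iff_inner_eq_zero K.zero_mem).mp key
  intro h hh
  simpa using h0 (B h) ⟨h, hh, rfl⟩

/-- If `B` is bounded below on the closed subspace `M`, then `‖B u‖` has a unique minimizer on
each coset of `M`. -/
lemma existsUnique_forall_norm_le [CompleteSpace H] {H' : Type*} [NormedAddCommGroup H']
    [InnerProductSpace ℂ H']
    (B : H →L[ℂ] H') (M : Submodule ℂ H) (hM : IsClosed (M : Set H)) {C : ℝ}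
    (hC : ∀ h ∈ M, ‖h‖ ^ 2 ≤ C * ‖B h‖ ^ 2) (f : H) :
    ∃! u, u - f ∈ M ∧ ∀ h ∈ M, ‖B u‖ ≤ ‖B (u + h)‖ := by
  have : CompleteSpace M := hM.completeSpace_coe
  set K : Submodule ℂ H' := M.map (B : H →ₗ[ℂ] H') with hK
  -- The lower bound makes `B` antilipschitz on the complete space `M`, so its image is complete and
  -- projections onto it exist.
  have hKc : IsComplete (K : Set H') := by
    set BM : M →L[ℂ] H' := B.comp M.subtypeL with hBM
    have ha : AntilipschitzWith (Real.toNNReal (Real.sqrt C)) BM := by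
      refine BM.antilipschitz_of_bound fun h => ?_
      have h1 := Real.sqrt_le_sqrt (hC h h.2)
      rw [Real.sqrt_sq (norm_nonneg _), Real.sqrt_mul' _ (sq_nonneg _),
        Real.sqrt_sq (norm_nonneg _)] at h1
      rwa [Real.coe_toNNReal _ (Real.sqrt_nonneg _)]
    have h2 := ha.isComplete_range BM.uniformContinuous
    have h3 : (K : Set H') = Set.range BM := by
      rw [hK, hBM, Submodule.map_coe, ContinuousLinearMap.coe_comp, Set.range_comp]
      simp
    rw [h3]
    exact h2
  obtain ⟨_, ⟨m, hm, rfl⟩, hmin⟩ := K.exists_norm_eq_iInf_of_complete_subspace hKc (B f)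
  refine ⟨f - m, ⟨by simpa using hm, fun h hh => ?_⟩, ?_⟩
  · have h1 : ‖B f - B m‖ ≤ ‖B f - B (m - h)‖ := by
      refine hmin.le.trans ?_
      exact ciInf_le ⟨0, by rintro _ ⟨w, rfl⟩; positivity⟩
        (⟨B (m - h), m - h, M.sub_mem hm hh, rfl⟩ : K)
    rw [← map_sub, ← map_sub] at h1
    convert h1 using 3
    abel
  -- For two minimizers, the difference of their images lies in `K` and is orthogonal to `K`, hence
  -- vanishes; the lower bound then makes the minimizers equal.
  · rintro u ⟨hu, hu'⟩
    have hd : u - (f - m) ∈ M := by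
      have := M.add_mem hu hm
      convert this using 1
      abel
    have h1 := inner_eq_zero_of_forall_norm_le B M hu' _ hd
    have h2 : inner ℂ (B f - B m) (B (u - (f - m))) = 0 :=
      (K.norm_eq_iInf_iff_inner_eq_zero ⟨m, hm, rfl⟩).mp hmin _ ⟨_, hd, rfl⟩
    have h3 : inner ℂ (B (u - (f - m))) (B (u - (f - m))) = 0 := by
      nth_rewrite 1 [map_sub]
      rw [inner_sub_left, h1, map_sub B f m, h2, sub_zero]
    have h4 := hC _ hd
    rw [inner_self_eq_zero.mp h3] at h4
    have h5 : ‖u - (f - m)‖ ^ 2 = 0 := le_antisymm (by simpa using h4) (sq_nonneg _)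
    exact sub_eq_zero.mp (norm_eq_zero.mp (pow_eq_zero_iff two_ne_zero |>.mp h5))

/-- Powers of a Poincaré inequality. -/
lemma norm_sq_le_pow_mul_inner {T : H →L[ℂ] H} (hT : (T : H →ₗ[ℂ] H).IsSymmetric)
    {a : ℝ} (ha : 0 ≤ a) {h : H} (hp : ‖h‖ ^ 2 ≤ a * RCLike.re (inner ℂ (T h) h)) (l : ℕ) :
    ‖h‖ ^ 2 ≤ a ^ 2 ^ l * RCLike.re (inner ℂ ((T ^ 2 ^ l) h) h) := by
  induction l with
  | zero => simpa using hp
  | succ l ih =>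
    set A := T ^ 2 ^ l with hA
    have hsymm : (A : H →ₗ[ℂ] H).IsSymmetric := by
      rw [hA, ContinuousLinearMap.toLinearMap_pow]
      exact hT.pow _
    set b := a ^ 2 ^ l with hb
    have hb0 : 0 ≤ b := pow_nonneg ha _
    have h1 : ‖h‖ ^ 2 ≤ b * (‖A h‖ * ‖h‖) :=
      ih.trans (mul_le_mul_of_nonneg_left (re_inner_le_norm _ _) hb0)
    -- Squaring this bound gives the next case, because ‖A h‖² = ⟨A² h, h⟩ for symmetric `A`.
    have h2 : ‖h‖ ≤ b * ‖A h‖ := by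
      rcases (norm_nonneg h).eq_or_lt with h0 | h0
      · rw [← h0]; positivity
      · refine le_of_mul_le_mul_right ?_ h0
        linarith
    have h3 : inner ℂ ((A * A) h) h = inner ℂ (A h) (A h) := hsymm (A h) h
    rw [pow_succ 2 l, pow_mul, pow_mul, ← hA, ← hb, pow_two A, h3, inner_self_eq_norm_sq, ← mul_pow]
    exact pow_le_pow_left₀ (norm_nonneg _) h2 2

end Hilbert

/-! ### Functional calculus estimates -/

section Calculus

variable {H : Type*} [NormedAddCommGroup H] [InnerProductSpace ℂ H] [CompleteSpace H]

/-- The pointwise bound gives φ(T)² ≤ ρ(T)² as operators, and the quadratic form of the square of a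
self-adjoint operator is a squared norm. -/
lemma norm_cfc_apply_le {T : H →L[ℂ] H} {φ ρ : ℝ → ℝ} (hφ : Continuous φ)
    (hρ : Continuous ρ) (hle : ∀ x ∈ spectrum ℝ T, |φ x| ≤ |ρ x|) (g : H) :
    ‖cfc φ T g‖ ≤ ‖cfc ρ T g‖ := by
  have h1 : cfc φ T * cfc φ T ≤ cfc ρ T * cfc ρ T := by
    rw [← cfc_mul φ φ T hφ.continuousOn hφ.continuousOn,
      ← cfc_mul ρ ρ T hρ.continuousOn hρ.continuousOn]
    exact cfc_mono (fun x hx => abs_le_iff_mul_self_le.mp (hle x hx))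
      (hφ.mul hφ).continuousOn (hρ.mul hρ).continuousOn
  have h2 : ∀ η : ℝ → ℝ, inner ℂ ((cfc η T * cfc η T) g) g = inner ℂ (cfc η T g) (cfc η T g) := by
    intro η
    have hsa : IsSelfAdjoint (cfc η T) := cfc_predicate _ T
    rw [mul_apply_eq_comp, ← ContinuousLinearMap.adjoint_inner_right, hsa.adjoint_eq]
  have h3 := ((ContinuousLinearMap.le_def _ _).mp h1).re_inner_nonneg_left g
  rw [sub_apply, inner_sub_left, h2, h2, map_sub, inner_self_eq_norm_sq,
    inner_self_eq_norm_sq] at h3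
  exact abs_le_of_sq_le_sq' (by linarith) (norm_nonneg _) |>.2

/-- Bernstein's inequality on the range of the spectral projection of a positive operator. -/
lemma norm_pow_apply_le_of_mem_range_spectralProjection {T : H →L[ℂ] H} (hT : 0 ≤ T) {ω : ℝ}
    (hω : 0 ≤ ω) {f : H} (hf : f ∈ LinearMap.range (spectralProjection T ω : H →ₗ[ℂ] H)) (k : ℕ) :
    ‖(T ^ k) f‖ ≤ ω ^ k * ‖f‖ := by
  obtain ⟨g, rfl⟩ := hf
  have hsa : IsSelfAdjoint T := .of_nonneg hT
  have hlim := tendsto_spectralProjection T ω g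
  have h1 : Tendsto (fun n => ‖(T ^ k) (cfc (cutoff ω n) T g)‖) atTop
      (𝓝 ‖(T ^ k) (spectralProjection T ω g)‖) :=
    (((T ^ k).continuous.tendsto _).comp hlim).norm
  have h2 : Tendsto (fun n : ℕ => (ω + 1 / (n : ℝ)) ^ k * ‖cfc (cutoff ω n) T g‖) atTop
      (𝓝 ((ω + 0) ^ k * ‖spectralProjection T ω g‖)) :=
    ((tendsto_const_nhds.add tendsto_one_div_atTop_nhds_zero_nat).pow k).mul hlim.norm
  rw [add_zero] at h2
  refine le_of_tendsto_of_tendsto h1 h2 ?_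
  -- For `n = 0` the cutoff is identically 1. For `n > 0` it vanishes beyond `ω + 1 / n`, so there
  -- x^k may be replaced by (ω + 1/n)^k on its support.
  filter_upwards [eventually_gt_atTop 0] with n hn
  have hn' : (0 : ℝ) < n := Nat.cast_pos.mpr hn
  have hc := continuous_cutoff ω n
  set b : ℝ := ω + 1 / n with hb
  have hb0 : 0 ≤ b := by positivity
  have e1 : (T ^ k) (cfc (cutoff ω n) T g) = cfc (fun x => x ^ k * cutoff ω n x) T g := by
    rw [cfc_mul (fun x => x ^ k) (cutoff ω n) T (continuous_pow k).continuousOn hc.continuousOn,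
      cfc_pow_id T k, mul_apply_eq_comp]
  have e2 : b ^ k * ‖cfc (cutoff ω n) T g‖ = ‖cfc (fun x => b ^ k * cutoff ω n x) T g‖ := by
    rw [cfc_const_mul (b ^ k) (cutoff ω n) T hc.continuousOn, smul_apply, norm_smul,
      Real.norm_of_nonneg (pow_nonneg hb0 k)]
  rw [e1, e2]
  refine norm_cfc_apply_le ((continuous_pow k).mul hc) (continuous_const.mul hc) ?_ g
  intro x hx
  have hx0 : 0 ≤ x := spectrum_nonneg_of_nonneg hT hx
  change |x ^ k * cutoff ω n x| ≤ |b ^ k * cutoff ω n x|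
  rw [abs_mul, abs_mul, abs_of_nonneg (pow_nonneg hx0 k), abs_of_nonneg (pow_nonneg hb0 k)]
  rcases le_or_gt x b with hxb | hxb
  · gcongr
  · have : cutoff ω n x = 0 := by
      refine max_eq_left ((min_le_right _ _).trans ?_)
      have : (1 : ℝ) / n < x - ω := by linarith
      rw [div_lt_iff₀ hn'] at this
      linarith
    simp [this]

lemma operatorPow_half_mul_self {T : H →L[ℂ] H} (hT : 0 ≤ T) (k : ℕ) :
    operatorPow T ((k : ℝ) / 2) * operatorPow T ((k : ℝ) / 2) = T ^ k := by
  have h1 := CFC.rpow_rpow_of_exponent_nonneg T ((k : ℝ) / 2) 2 (by positivity) zero_le_two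
  have h2 := CFC.rpow_natCast (T ^ ((k : ℝ) / 2)) 2 CFC.rpow_nonneg
  rw [div_mul_cancel₀ _ two_ne_zero, CFC.rpow_natCast T k] at h1
  rw [Nat.cast_ofNat, h1, pow_two] at h2
  exact h2.symm

/-- Moving one self-adjoint half power across the inner product replaces the fractional power by `T
^ k`, to which the Poincaré and Bernstein estimates apply. -/
lemma inner_operatorPow_half {T : H →L[ℂ] H} (hT : 0 ≤ T) (k : ℕ) (x y : H) :
    inner ℂ (operatorPow T ((k : ℝ) / 2) x) (operatorPow T ((k : ℝ) / 2) y) =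
      inner ℂ ((T ^ k) x) y := by
  have hsa : IsSelfAdjoint (operatorPow T ((k : ℝ) / 2)) := .of_nonneg CFC.rpow_nonneg
  rw [← operatorPow_half_mul_self hT k, mul_apply_eq_comp,
    ← ContinuousLinearMap.adjoint_inner_right _ (operatorPow T ((k : ℝ) / 2) x), hsa.adjoint_eq]

/-- Error estimate for variational interpolation. -/
lemma norm_sub_le_of_inner_eq_zero {T : H →L[ℂ] H} (hT : 0 ≤ T) {k : ℕ} {a b : ℝ} (ha : 0 ≤ a)
    {f s : H} (hp : ‖f - s‖ ^ 2 ≤ a * RCLike.re (inner ℂ ((T ^ k) (f - s)) (f - s)))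
    (hf : ‖(T ^ k) f‖ ≤ b * ‖f‖)
    (horth : inner ℂ (operatorPow T ((k : ℝ) / 2) s) (operatorPow T ((k : ℝ) / 2) (f - s)) = 0) :
    ‖f - s‖ ≤ a * b * ‖f‖ := by
  rw [inner_operatorPow_half hT] at horth
  -- Orthogonality deletes the `s` term: ⟨T^k(f - s), f - s⟩ = ⟨T^k f, f - s⟩.
  nth_rewrite 1 [map_sub] at hp
  rw [inner_sub_left, horth, sub_zero] at hp
  have h1 : ‖f - s‖ ^ 2 ≤ a * (b * ‖f‖ * ‖f - s‖) :=
    hp.trans (mul_le_mul_of_nonneg_left ((re_inner_le_norm _ _).trans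
      (mul_le_mul_of_nonneg_right hf (norm_nonneg _))) ha)
  rcases (norm_nonneg (f - s)).eq_or_lt with h0 | h0
  · rw [← h0, mul_assoc]
    exact mul_nonneg ha ((norm_nonneg _).trans hf)
  · refine le_of_mul_le_mul_right ?_ h0
    linarith

end Calculus

/-! ### Restriction to a finite set of vertices -/

section Restrict

variable {V : Type*}

/-- Restriction of a function in `ℓ²(V)` to a finite set. -/
def restrict (s : Finset V) (h : L2 V) : L2 (s : Set V) :=
  ⟨fun v => h v, haveI : Finite (s : Set V) := s.finite_toSet; Memℓp.all _⟩

/-- Only `ψ` has to be supported in `s`, so the condition ⟨ψ, h⟩ = 0 passes to the block for an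
arbitrary `h`. -/
lemma inner_restrict (s : Finset V) {ψ : L2 V} (hψ : ∀ v, v ∉ s → ψ v = 0) (h : L2 V) :
    inner ℂ (restrict s ψ) (restrict s h) = inner ℂ ψ h := by
  rw [lp.inner_eq_tsum, lp.inner_eq_tsum]
  refine tsum_subtype_eq_of_support_subset (f := fun v => inner ℂ (ψ v) (h v)) (s := (s : Set V)) ?_
  intro v hv
  by_contra hvs
  exact hv (by simp [hψ v hvs])

lemma norm_sq_restrict (s : Finset V) (h : L2 V) : ‖restrict s h‖ ^ 2 = ∑ v ∈ s, ‖h v‖ ^ 2 := by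
  rw [WeightedGraph.norm_sq_eq]
  exact Finset.tsum_subtype s fun v => ‖h v‖ ^ 2

lemma norm_restrict (s : Finset V) {ψ : L2 V} (hψ : ∀ v, v ∉ s → ψ v = 0) :
    ‖restrict s ψ‖ = ‖ψ‖ := by
  rw [norm_eq_sqrt_re_inner (𝕜 := ℂ), inner_restrict s hψ, ← norm_eq_sqrt_re_inner]

lemma charFun_apply (s : Finset V) {v : V} (hv : v ∈ s) : charFun s v = 1 := by
  classical
  rw [charFun, lp.coeFn_sum, Finset.sum_apply, Finset.sum_eq_single_of_mem v hv]
  · simp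
  · intro u _ huv
    simp [huv.symm]

lemma norm_sq_restrict_charFun (s : Finset V) : ‖restrict s (charFun s)‖ ^ 2 = s.card := by
  rw [norm_sq_restrict, Finset.sum_congr rfl fun v hv => by rw [charFun_apply s hv]]
  simp

end Restrict

/-! ### Poincaré inequalities -/

lemma theta_nonneg {V : Type*} (S : Finset V) (ψ : L2 V) : 0 ≤ theta S ψ := by
  unfold theta; positivity

namespace WeightedGraph

variable {V : Type*} (G : WeightedGraph V)

lemma norm_sq_gradient (h : L2 V) :
    ‖G.gradient h‖ ^ 2 = ∑' p : V × V, G.weight p.1 p.2 / 2 * ‖h p.1 - h p.2‖ ^ 2 := by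
  rw [norm_sq_eq]
  exact tsum_congr fun p => G.norm_gradFun_sq h p

/-- Since L = ∇*∇, the quadratic form of L is the Dirichlet energy, which can be split over edges.
-/
lemma inner_laplacian_self (h : L2 V) :
    inner ℂ (G.laplacian h) h = ((‖G.gradient h‖ ^ 2 : ℝ) : ℂ) := by
  rw [laplacian_eq, ContinuousLinearMap.comp_apply, ContinuousLinearMap.adjoint_inner_left,
    inner_self_eq_norm_sq_to_K]
  simp

lemma isSymmetric_laplacian : (G.laplacian : L2 V →ₗ[ℂ] L2 V).IsSymmetric :=
  ((ContinuousLinearMap.nonneg_iff_isPositive _).mp G.laplacian_nonneg).isSymmetric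

lemma eigenvalue_nonneg {μ : ℝ}
    (hμ : Module.End.HasEigenvalue (G.laplacian : L2 V →ₗ[ℂ] L2 V) (μ : ℂ)) : 0 ≤ μ := by
  obtain ⟨x, hx⟩ := hμ.exists_hasEigenvector
  have h1 := G.inner_laplacian_self x
  have h2 : G.laplacian x = (μ : ℂ) • x := hx.apply_eq_smul
  rw [h2, inner_smul_left, Complex.conj_ofReal, inner_self_eq_norm_sq_to_K] at h1
  have h3 : μ * ‖x‖ ^ 2 = ‖G.gradient x‖ ^ 2 := by
    apply Complex.ofReal_injective
    rw [← h1]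
    push_cast
    rfl
  have h4 : 0 < ‖x‖ ^ 2 := by have := norm_pos_iff.mpr hx.2; positivity
  by_contra! hneg
  nlinarith [sq_nonneg ‖G.gradient x‖]

/-- This includes the case of no nonzero eigenvalue, where the infimum of the empty set is 0. -/
lemma firstEigenvalue_nonneg : 0 ≤ G.firstEigenvalue :=
  Real.sInf_nonneg fun _ hμ => G.eigenvalue_nonneg hμ.2

lemma firstEigenvalue_le {μ : ℝ} (h0 : μ ≠ 0)
    (hμ : Module.End.HasEigenvalue (G.laplacian : L2 V →ₗ[ℂ] L2 V) (μ : ℂ)) :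
    G.firstEigenvalue ≤ μ :=
  csInf_le ⟨0, fun _ h => G.eigenvalue_nonneg h.2⟩ ⟨h0, hμ⟩

/-- On a connected graph, harmonic functions of finite energy are constant. -/
lemma apply_eq_apply_of_laplacian_eq_zero (hG : G.toSimpleGraph.Connected) {x : L2 V}
    (hx : G.laplacian x = 0) (u v : V) : x u = x v := by
  have h1 := G.inner_laplacian_self x
  rw [hx, inner_zero_left] at h1
  have h2 : ‖G.gradient x‖ ^ 2 = 0 := by exact_mod_cast h1.symm
  have h3 : G.gradient x = 0 := norm_eq_zero.mp (pow_eq_zero_iff two_ne_zero |>.mp h2)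
  obtain ⟨p⟩ := hG.preconnected u v
  induction p with
  | nil => rfl
  | cons hadj _ ih =>
    rename_i a b _ _
    have h4 : G.gradient x (a, b) = 0 := by rw [h3]; rfl
    rw [gradient_apply, mul_eq_zero] at h4
    have hw : G.weight a b ≠ 0 := hadj
    have hpos : 0 < G.weight a b / 2 := half_pos ((G.weight_nonneg a b).lt_of_ne' hw)
    rcases h4 with h4 | h4
    · exact absurd (Complex.ofReal_eq_zero.mp h4) (Real.sqrt_pos.mpr hpos).ne'
    · exact (sub_eq_zero.mp h4).trans ih

/-- The spectral gap inequality on a finite connected graph. -/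
lemma firstEigenvalue_mul_norm_sq_le [Finite V] (hG : G.toSimpleGraph.Connected) {χ g : L2 V}
    (hχ : ∀ v, χ v = 1) (hg : inner ℂ χ g = 0) :
    G.firstEigenvalue * ‖g‖ ^ 2 ≤ ‖G.gradient g‖ ^ 2 := by
  have : Fintype V := Fintype.ofFinite V
  have hfin : FiniteDimensional ℂ (L2 V) :=
    (lpPiLpₗᵢ (fun _ : V => ℂ) (p := 2) ℂ).symm.toLinearEquiv.finiteDimensional
  set T := (G.laplacian : L2 V →ₗ[ℂ] L2 V) with hTdef
  have hT : T.IsSymmetric := G.isSymmetric_laplacian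
  set e := hT.eigenvectorBasis rfl with he
  set μ := hT.eigenvalues rfl with hμ
  have hTe : ∀ i, T (e i) = ((μ i : ℝ) : ℂ) • e i := hT.apply_eigenvectorBasis rfl
  have h1 : ‖G.gradient g‖ ^ 2 = ∑ i, μ i * ‖inner ℂ (e i) g‖ ^ 2 := by
    have h2 : inner ℂ (T g) g = ((‖G.gradient g‖ ^ 2 : ℝ) : ℂ) := G.inner_laplacian_self g
    rw [← e.sum_inner_mul_inner] at h2
    apply Complex.ofReal_injective
    rw [← h2, Complex.ofReal_sum]
    refine Finset.sum_congr rfl fun i _ => ?_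
    rw [hT, hTe, inner_smul_right, mul_assoc, ← inner_conj_symm g, Complex.conj_mul']
    push_cast
    rfl
  rw [h1, ← e.sum_sq_norm_inner_right g, Finset.mul_sum]
  refine Finset.sum_le_sum fun i _ => ?_
  -- Eigenvectors for 0 are constant by connectedness, hence orthogonal to `g` and absent from its
  -- expansion; all other modes have eigenvalue at least λ₁.
  by_cases h0 : μ i = 0
  · have h2 : G.laplacian (e i) = 0 := by
      have := hTe i
      rw [h0, Complex.ofReal_zero, zero_smul] at this
      exact this
    obtain ⟨v₀⟩ := hG.nonempty
    have h3 : e i = (e i v₀) • χ := by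
      ext v
      rw [lp.coeFn_smul, Pi.smul_apply, hχ, smul_eq_mul, mul_one]
      exact G.apply_eq_apply_of_laplacian_eq_zero hG h2 v v₀
    have h4 : inner ℂ (e i) g = 0 := by rw [h3, inner_smul_left, hg, mul_zero]
    simp [h4]
  · exact mul_le_mul_of_nonneg_right
      (G.firstEigenvalue_le h0 (hT.hasEigenvalue_eigenvalues rfl i)) (sq_nonneg _)

/-- The Poincaré inequality on a block, for functions annihilated by `ψ`. -/
lemma firstEigenvalue_mul_sum_le (s : Finset V)
    (hconn : (G.induce (s : Set V)).toSimpleGraph.Connected) {ψ : L2 V}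
    (hsupp : ∀ v, v ∉ s → ψ v = 0) (hψ : inner ℂ ψ (charFun s) ≠ 0) {h : L2 V}
    (hh : inner ℂ ψ h = 0) :
    (G.induce (s : Set V)).firstEigenvalue * ∑ v ∈ s, ‖h v‖ ^ 2 ≤
      theta s ψ * ∑ p ∈ s ×ˢ s, G.weight p.1 p.2 / 2 * ‖h p.1 - h p.2‖ ^ 2 := by
  have hfin : Finite (s : Set V) := s.finite_toSet
  set G' := G.induce (s : Set V) with hG'
  set χ := restrict s (charFun s) with hχ
  have hχ1 : ∀ v, χ v = 1 := fun v => charFun_apply s v.2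
  have hχχ : inner ℂ χ χ ≠ 0 := by
    intro h0
    apply hψ
    rw [← inner_restrict s hsupp, ← hχ, inner_self_eq_zero.mp h0, inner_zero_right]
  set x := restrict s h with hx
  -- `c` is the mean of `h` over the block, so `g` is the part orthogonal to constants.
  set c : ℂ := inner ℂ χ x / inner ℂ χ χ with hc
  set g := x - c • χ with hg
  have hgχ : inner ℂ χ g = 0 := by
    rw [hg, inner_sub_right, inner_smul_right, hc, div_mul_cancel₀ _ hχχ, sub_self]
  have hxg : x = g + c • χ := by rw [hg, sub_add_cancel]
  have h1 := norm_sq_add_smul_le (restrict s ψ) hgχ (c := c)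
    (by rw [← hxg, inner_restrict s hsupp, hh])
  rw [← hxg, norm_restrict s hsupp, inner_restrict s hsupp, norm_sq_restrict_charFun,
    norm_sq_restrict] at h1
  have h2 := G'.firstEigenvalue_mul_norm_sq_le hconn hχ1 hgχ
  -- The gradient ignores the constant `c`, so `g` has the energy of `h` inside the block.
  have h3 : ‖G'.gradient g‖ ^ 2 =
      ∑ p ∈ s ×ˢ s, G.weight p.1 p.2 / 2 * ‖h p.1 - h p.2‖ ^ 2 := by
    have : Fintype (s : Set V) := Fintype.ofFinite _
    rw [norm_sq_gradient, tsum_fintype, Fintype.sum_prod_type, Finset.sum_product]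
    have hgu : ∀ u : (s : Set V), g u = h u - c := by
      intro u
      rw [hg, lp.coeFn_sub, Pi.sub_apply, lp.coeFn_smul, Pi.smul_apply, hχ1, smul_eq_mul, mul_one]
      rfl
    have hsum : ∀ F : V → ℝ, ∑ u : (s : Set V), F u = ∑ u ∈ s, F u := fun F => by
      rw [← tsum_fintype (L := .unconditional _)]
      exact Finset.tsum_subtype s F
    rw [← hsum fun u => ∑ v ∈ s, G.weight u v / 2 * ‖h u - h v‖ ^ 2]
    refine Finset.sum_congr rfl fun u _ => ?_
    rw [← hsum fun v => G.weight u v / 2 * ‖h u - h v‖ ^ 2]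
    refine Finset.sum_congr rfl fun v _ => ?_
    rw [hgu, hgu, sub_sub_sub_cancel_right]
    rfl
  have hpos : 0 < ‖inner ℂ ψ (charFun s)‖ ^ 2 := by
    have := norm_pos_iff.mpr hψ
    positivity
  have h4 : ∑ v ∈ s, ‖h v‖ ^ 2 ≤ theta s ψ * ‖g‖ ^ 2 := by
    rw [theta, div_mul_eq_mul_div, le_div_iff₀ hpos]
    linarith
  have hθ := theta_nonneg s ψ
  calc G'.firstEigenvalue * ∑ v ∈ s, ‖h v‖ ^ 2
      ≤ G'.firstEigenvalue * (theta s ψ * ‖g‖ ^ 2) :=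
        mul_le_mul_of_nonneg_left h4 G'.firstEigenvalue_nonneg
    _ = theta s ψ * (G'.firstEigenvalue * ‖g‖ ^ 2) := by ring
    _ ≤ _ := by rw [← h3]; exact mul_le_mul_of_nonneg_left h2 hθ

/-- The global Poincaré inequality obtained from a family of block inequalities. -/
lemma norm_sq_le_of_forall_block {J : Type*} (S : J → Finset V) (hcover : ∀ v, ∃ j, v ∈ S j)
    (hdisj : ∀ i j, i ≠ j → Disjoint (S i) (S j)) {a : ℝ} (ha : 0 ≤ a) {h : L2 V}
    (hblock : ∀ j, ∑ v ∈ S j, ‖h v‖ ^ 2 ≤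
      a * ∑ p ∈ S j ×ˢ S j, G.weight p.1 p.2 / 2 * ‖h p.1 - h p.2‖ ^ 2) :
    ‖h‖ ^ 2 ≤ a * RCLike.re (inner ℂ (G.laplacian h) h) := by
  classical
  rw [G.inner_laplacian_self h, RCLike.re_to_complex, Complex.ofReal_re, norm_sq_eq,
    norm_sq_gradient]
  choose j hj using hcover
  obtain ⟨C, hC⟩ := G.degree_bounded
  obtain ⟨_, -, hs⟩ := G.exists_hasSum_grad h C hC
  have hnn : ∀ p : V × V, 0 ≤ G.weight p.1 p.2 / 2 * ‖h p.1 - h p.2‖ ^ 2 := fun p =>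
    mul_nonneg (div_nonneg (G.weight_nonneg _ _) zero_le_two) (sq_nonneg _)
  -- A finite set of vertices meets only finitely many blocks, so no summation over all of `J` is
  -- needed.
  refine (summable_sq h).tsum_le_of_sum_le fun F => ?_
  set I := F.image j with hI
  calc ∑ v ∈ F, ‖h v‖ ^ 2 ≤ ∑ v ∈ I.biUnion S, ‖h v‖ ^ 2 := by
        refine Finset.sum_le_sum_of_subset_of_nonneg (fun v hv => ?_) fun _ _ _ => sq_nonneg _
        exact Finset.mem_biUnion.mpr ⟨j v, Finset.mem_image_of_mem _ hv, hj v⟩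
    _ = ∑ i ∈ I, ∑ v ∈ S i, ‖h v‖ ^ 2 :=
        Finset.sum_biUnion fun i _ k _ hik => hdisj i k hik
    _ ≤ ∑ i ∈ I, a * ∑ p ∈ S i ×ˢ S i, G.weight p.1 p.2 / 2 * ‖h p.1 - h p.2‖ ^ 2 :=
        Finset.sum_le_sum fun i _ => hblock i
    _ = a * ∑ p ∈ I.biUnion fun i => S i ×ˢ S i, G.weight p.1 p.2 / 2 * ‖h p.1 - h p.2‖ ^ 2 := by
        rw [← Finset.mul_sum, Finset.sum_biUnion]
        exact fun i _ k _ hik => Finset.disjoint_product.mpr (Or.inl (hdisj i k hik))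
    -- The edges between different blocks are discarded here.
    _ ≤ _ := mul_le_mul_of_nonneg_left (hs.summable.sum_le_tsum _ fun p _ => hnn p) ha

lemma coverLambda_le {J : Type*} (S : J → Finset V) (j : J) :
    G.coverLambda S ≤ (G.induce (S j : Set V)).firstEigenvalue :=
  ciInf_le ⟨0, by rintro _ ⟨i, rfl⟩; exact firstEigenvalue_nonneg _⟩ j

end WeightedGraph

/-! ### Reconstruction by variational splines -/

theorem mainTheorem7 {V J : Type*} [Countable V] (G : WeightedGraph V)
    (hG : G.toSimpleGraph.Connected)
    (S : J → Finset V)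
    (hcover : ∀ v, ∃ j, v ∈ S j)
    (hdisj : ∀ i j, i ≠ j → Disjoint (S i) (S j))
    (hconn : ∀ j, (G.induce (S j : Set V)).toSimpleGraph.Connected)
    (hcard : ∀ j, 1 < (S j).card)
    (ψ : J → L2 V)
    (hsupp : ∀ j, ∀ v, v ∉ S j → ψ j v = 0)
    (hψ : ∀ j, inner ℂ (ψ j) (charFun (S j)) ≠ 0)
    (hΘ : BddAbove (Set.range fun j => theta (S j) (ψ j)))
    (ω : ℝ) (hω : 0 < ω) (hω' : ω < G.coverLambda S / coverTheta S ψ)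
    (f : L2 V) (hf : f ∈ G.paleyWiener ω) :
    coverTheta S ψ / G.coverLambda S * ω < 1 ∧
    (∀ l : ℕ, ∃! u : L2 V, G.IsVariationalSpline ψ (2 ^ l) (fun j => inner ℂ (ψ j) f) u) ∧
    ∀ s : ℕ → L2 V,
      (∀ l, G.IsVariationalSpline ψ (2 ^ l) (fun j => inner ℂ (ψ j) f) (s l)) →
      Tendsto s atTop (𝓝 f) ∧
      ∀ l, ‖f - s l‖ ≤ 2 * (coverTheta S ψ / G.coverLambda S * ω) ^ (2 ^ l) * ‖f‖ := by
  have hΘ0 : 0 ≤ coverTheta S ψ := Real.iSup_nonneg fun j => theta_nonneg _ _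
  -- If Θ were 0, the quotient Λ/Θ would be 0 by convention, contradicting 0 < ω < Λ/Θ.
  have hΘpos : 0 < coverTheta S ψ := by
    refine hΘ0.lt_of_ne fun h0 => ?_
    rw [← h0, div_zero] at hω'
    exact hω.not_gt hω'
  have hΛpos : 0 < G.coverLambda S := by
    have := (div_pos_iff_of_pos_right hΘpos).mp (hω.trans hω')
    exact this
  set a := coverTheta S ψ / G.coverLambda S with ha
  have ha0 : 0 < a := div_pos hΘpos hΛpos
  have hγ : a * ω < 1 := by
    rw [lt_div_iff₀ hΘpos] at hω'
    rw [ha, div_mul_eq_mul_div, div_lt_one hΛpos]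
    linarith
  set M : Submodule ℂ (L2 V) := ⨅ j, LinearMap.ker (innerSL ℂ (ψ j) : L2 V →ₗ[ℂ] ℂ) with hM
  have hmem : ∀ h, h ∈ M ↔ ∀ j, inner ℂ (ψ j) h = 0 := by
    intro h
    simp [hM]
  have hMc : IsClosed (M : Set (L2 V)) := by
    rw [hM, Submodule.coe_iInf]
    exact isClosed_iInter fun j => (innerSL ℂ (ψ j)).isClosed_ker
  have hL := G.laplacian_nonneg
  have hpoin : ∀ h ∈ M, ∀ l : ℕ,
      ‖h‖ ^ 2 ≤ a ^ 2 ^ l * RCLike.re (inner ℂ ((G.laplacian ^ 2 ^ l) h) h) := by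
    intro h hh l
    refine norm_sq_le_pow_mul_inner G.isSymmetric_laplacian ha0.le ?_ l
    refine G.norm_sq_le_of_forall_block S hcover hdisj ha0.le fun j => ?_
    have h1 := G.firstEigenvalue_mul_sum_le (S j) (hconn j) (hsupp j) (hψ j) ((hmem h).mp hh j)
    have hE : 0 ≤ ∑ p ∈ S j ×ˢ S j, G.weight p.1 p.2 / 2 * ‖h p.1 - h p.2‖ ^ 2 :=
      Finset.sum_nonneg fun p _ =>
        mul_nonneg (div_nonneg (G.weight_nonneg _ _) zero_le_two) (sq_nonneg _)
    have h2 : theta (S j) (ψ j) ≤ coverTheta S ψ := le_ciSup hΘ j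
    have h3 := G.coverLambda_le S j
    have h4 : 0 ≤ ∑ v ∈ S j, ‖h v‖ ^ 2 := Finset.sum_nonneg fun _ _ => sq_nonneg _
    rw [ha, div_mul_eq_mul_div, le_div_iff₀ hΛpos, mul_comm]
    exact (mul_le_mul_of_nonneg_right h3 h4).trans
      (h1.trans (mul_le_mul_of_nonneg_right h2 hE))
  -- The admissible functions form the coset `f + M`, which puts the problem in the form of the
  -- abstract minimization lemmas.
  have hspline : ∀ (l : ℕ) (u : L2 V),
      G.IsVariationalSpline ψ (2 ^ l) (fun j => inner ℂ (ψ j) f) u ↔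
      u - f ∈ M ∧ ∀ h ∈ M, ‖operatorPow G.laplacian (((2 ^ l : ℕ) : ℝ) / 2) u‖ ≤
        ‖operatorPow G.laplacian (((2 ^ l : ℕ) : ℝ) / 2) (u + h)‖ := by
    intro l u
    have hiff : ∀ v, v - f ∈ M ↔ ∀ j, inner ℂ (ψ j) v = inner ℂ (ψ j) f := by
      simp [hmem, sub_eq_zero]
    simp only [WeightedGraph.IsVariationalSpline, ← hiff]
    refine and_congr_right fun hu => ⟨fun H h hh => H _ ?_, fun H v hv => ?_⟩
    · rw [add_sub_right_comm]
      exact M.add_mem hu hh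
    · have h1 := H (v - u) (by simpa using M.sub_mem hv hu)
      rwa [add_sub_cancel] at h1
  refine ⟨hγ, fun l => ?_, fun s hs => ?_⟩
  · simp only [hspline]
    refine existsUnique_forall_norm_le _ M hMc (C := a ^ 2 ^ l) (fun h hh => ?_) f
    have := hpoin h hh l
    rwa [← inner_operatorPow_half hL, inner_self_eq_norm_sq] at this
  have hbound : ∀ l, ‖f - s l‖ ≤ (a * ω) ^ 2 ^ l * ‖f‖ := by
    intro l
    obtain ⟨h1, h2⟩ := (hspline l (s l)).mp (hs l)
    have h3 : f - s l ∈ M := by rw [← neg_sub]; exact M.neg_mem h1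
    rw [mul_pow]
    exact norm_sub_le_of_inner_eq_zero hL (pow_nonneg ha0.le _) (hpoin _ h3 l)
      (norm_pow_apply_le_of_mem_range_spectralProjection hL hω.le hf _)
      (inner_eq_zero_of_forall_norm_le _ M h2 _ h3)
  have hγ0 : 0 ≤ a * ω := by positivity
  refine ⟨?_, fun l => (hbound l).trans ?_⟩
  · rw [tendsto_iff_norm_sub_tendsto_zero]
    have h1 : Tendsto (fun l : ℕ => (a * ω) ^ 2 ^ l * ‖f‖) atTop (𝓝 (0 * ‖f‖)) :=
      ((tendsto_pow_atTop_nhds_zero_of_lt_one hγ0 hγ).comp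
        (tendsto_pow_atTop_atTop_of_one_lt one_lt_two)).mul_const _
    rw [zero_mul] at h1
    exact squeeze_zero (fun _ => norm_nonneg _)
      (fun l => by rw [norm_sub_rev]; exact hbound l) h1
  -- The estimate `hbound` holds with constant 1, so the factor 2 is slack.
  · have : 0 ≤ (a * ω) ^ 2 ^ l * ‖f‖ := by positivity
    linarith

end
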